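/- Let $(B_t)_{t\ge 0}$ be a standard one-dimensional Brownian motion (with almost surely continuous paths, $B_0=0$ a.s.) on a probability space $(\Omega,\mathcal F,\mathbb P)$, let $S_t := B_{t+1}-B_t$, $t\ge 0$, be the Slepian process, and let $F := \inf\{t\ge 0 : S_t = 0\}\in[0,\infty]$, with $\inf\emptyset=\infty$. Then $F$ is a random variable (measurable up to null sets) whose law restricted to $[0,1]$ has density $\frac1\pi\sqrt{\frac{2-a}{a}}$ with respect to Lebesgue measure, i.e. $$\mathbb P(F\in A)=\int_A \frac1\pi\sqrt{\frac{2-a}{a}}\,da\qquad\text{for every Borel set } A\subseteq[0,1].$$ Consequently $\mathbb P(F\le 1)=\frac12+\frac1\pi$. -/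

import Mathlib

open MeasureTheory ProbabilityTheory
open scoped NNReal ENNReal

/-- The Slepian process `S_t = B_{t+1} - B_t`, `t ≥ 0`, built from a process `B`. -/
def slepianProcess {Ω : Type*} (B : ℝ≥0 → Ω → ℝ) : ℝ≥0 → Ω → ℝ :=
  fun t ω => B (t + 1) ω - B t ω

/-- The first zero `inf {t ≥ 0 : X_t = 0}` of a process `X`, as an extended nonnegative real;
it is `∞` on paths that have no zero. -/
noncomputable def firstZero {Ω : Type*} (X : ℝ≥0 → Ω → ℝ) (ω : Ω) : ℝ≥0∞ :=
  sInf {s : ℝ≥0∞ | ∃ t : ℝ≥0, s = (t : ℝ≥0∞) ∧ X t ω = 0}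

/-!
Fix `0 < a ≤ 1` and let `S` be the Slepian process. On `[0, 1]` it is Gaussian with covariance
`1 - |s - t|`, so the drop `V_t = S_0 - S_t` (`slepianDrop`) is there a Brownian motion of variance
`2 t`, and the midpoint `N = (S_0 + S_a) / 2` (`slepianMidpoint`), of variance `1 - a / 2`, is
independent of `(V_t)_{t ≤ a}`. Since `S_t = N + V_a / 2 - V_t`, the process `S` is positive on
`[0, a]` exactly when `M < N + V_a / 2`, where `M` is the maximum of `V` over `[0, a]`.

Disintegrate this event along the value `x` of `S_0 = N + V_a / 2`, with `ρ` the density of `N`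
(`measure_lt_add_half`): for given `x` the condition on `V` is `M ≤ x`, with a weight
`ρ (x - V_a / 2)` that depends on `V` only through its endpoint. The reflection principle
(`HasSymmIncrements.map_restrict_reflect`) therefore applies with the constant level `x`. It shows
that the event has the probability of `{S_0 > 0, S_a ≥ 0}`, which is
`arctan (√(2 - a) / √a) / π`, minus the integral over `x > 0` of the mean of `ρ (V_a / 2)` on
`{V_a > x}`, which is `√(a (2 - a)) / (2 π)` (`measure_lt_add_half_add`,
`IsBrownianReal.measure_slepian_pos`).

A continuous path without zeros in `[0, a]` is positive there or negative there, and these two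
events have the same probability, as `-B` is a Brownian motion. Hence
`P(F ≤ a) = (2 / π) arctan √(a / (2 - a)) + √(a (2 - a)) / π` (`slepianZeroCDF`), and the
derivative of this function is the density claimed.

The reflection principle itself is proved on the grids `k a / (n + 1)`: reflecting the path after
the first grid point at which it exceeds `m` preserves its law, because the increments are
symmetric and independent of the past, and as the mesh tends to zero the level reached there tends
to `m`.
-/

open Filter Topology

/-! ### Running suprema of continuous paths -/

/-- The running supremum of `X` over `[0, a]`, taken along a countable dense set of times, so that
it is measurable as soon as every `X t` is. For a continuous path it is the maximum. -/
noncomputable def runningSup {Ω : Type*} (X : ℝ≥0 → Ω → ℝ) (a : ℝ≥0) (ω : Ω) : ℝ :=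
  ⨆ n : ℕ, X (TopologicalSpace.denseSeq (Set.Iic a) n) ω

section runningSup

variable {Ω : Type*} {mΩ : MeasurableSpace Ω} {P : Measure Ω} {X : ℝ≥0 → Ω → ℝ} {a : ℝ≥0}

lemma isCompact_Iic_nnreal (a : ℝ≥0) : IsCompact (Set.Iic a) := by
  have : Set.Iic a = Set.Icc 0 a := by ext; simp
  rw [this]
  exact isCompact_Icc

lemma le_runningSup {ω : Ω} (hX : Continuous (X · ω)) {t : ℝ≥0} (ht : t ≤ a) :
    X t ω ≤ runningSup X a ω := by
  obtain ⟨b, hb⟩ := (isCompact_Iic_nnreal a).bddAbove_image (f := (X · ω)) hX.continuousOn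
  have hbdd : BddAbove (Set.range fun n : ℕ ↦
      X (TopologicalSpace.denseSeq (Set.Iic a) n) ω) := by
    refine ⟨b, ?_⟩
    rintro _ ⟨n, rfl⟩
    exact hb ⟨_, (TopologicalSpace.denseSeq (Set.Iic a) n).2, rfl⟩
  have hclosed : IsClosed {s : Set.Iic a | X s ω ≤ runningSup X a ω} :=
    isClosed_le (hX.comp continuous_subtype_val) continuous_const
  have huniv := (TopologicalSpace.denseRange_denseSeq (Set.Iic a)).closure_eq
  have hsub : closure (Set.range (TopologicalSpace.denseSeq (Set.Iic a))) ⊆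
      {s : Set.Iic a | X s ω ≤ runningSup X a ω} := by
    refine closure_minimal ?_ hclosed
    rintro _ ⟨n, rfl⟩
    exact le_ciSup hbdd n
  rw [huniv] at hsub
  exact hsub (Set.mem_univ (⟨t, ht⟩ : Set.Iic a))

lemma exists_eq_runningSup {ω : Ω} (hX : Continuous (X · ω)) :
    ∃ t ≤ a, X t ω = runningSup X a ω := by
  obtain ⟨t, ht, hmax⟩ := (isCompact_Iic_nnreal a).exists_isMaxOn ⟨a, le_refl a⟩ hX.continuousOn
  refine ⟨t, ht, le_antisymm (le_runningSup hX ht) (ciSup_le fun n ↦ ?_)⟩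
  exact hmax (TopologicalSpace.denseSeq (Set.Iic a) n).2

lemma runningSup_lt_iff {ω : Ω} (hX : Continuous (X · ω)) {m : ℝ} :
    runningSup X a ω < m ↔ ∀ t ≤ a, X t ω < m := by
  refine ⟨fun h t ht ↦ (le_runningSup hX ht).trans_lt h, fun h ↦ ?_⟩
  obtain ⟨t, ht, hXt⟩ := exists_eq_runningSup (a := a) hX
  exact hXt ▸ h t ht

lemma aemeasurable_runningSup (hX : ∀ t, AEMeasurable (X t) P) :
    AEMeasurable (runningSup X a) P := by
  unfold runningSup
  exact AEMeasurable.iSup fun n ↦ hX _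

end runningSup

/-! ### The reflection principle -/

/-- The `k`-th point of the grid of mesh `a / (n + 1)`; the points with `k ≤ n + 1` cut `[0, a]`
into `n + 1` equal pieces. -/
noncomputable def gridTime (a : ℝ≥0) (n k : ℕ) : ℝ≥0 := a * k / (n + 1)

lemma gridTime_mono (a : ℝ≥0) (n : ℕ) : Monotone (gridTime a n) := fun i j hij ↦ by
  unfold gridTime
  gcongr

lemma gridTime_le {a : ℝ≥0} {n k : ℕ} (hk : k ≤ n + 1) : gridTime a n k ≤ a := by
  unfold gridTime
  rw [div_le_iff₀ (by positivity)]
  gcongr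
  exact_mod_cast hk

@[simp] lemma gridTime_zero (a : ℝ≥0) (n : ℕ) : gridTime a n 0 = 0 := by simp [gridTime]

lemma dist_gridTime_succ (a : ℝ≥0) (n k : ℕ) :
    dist (gridTime a n (k + 1)) (gridTime a n k) = a / (n + 1) := by
  rw [NNReal.dist_eq, gridTime, gridTime]
  push_cast
  rw [← sub_div, abs_of_nonneg (by ring_nf; positivity)]
  ring

/-- The path `v` exceeds the level `m` at the `k`-th grid point, for the first time on the grid.
Exceeding is strict, so that a crossing on some grid is the same as `m < max v`, with no need to
know that the event `max v = m` is null. -/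
def IsFirstCrossing (v : ℝ≥0 → ℝ) (a : ℝ≥0) (m : ℝ) (n k : ℕ) : Prop :=
  m < v (gridTime a n k) ∧ ∀ j < k, v (gridTime a n j) ≤ m

open Classical in
/-- The value of `g` at the level reached by `v` when it first exceeds `m` on the grid of `[0, a]`,
and `0` if it does not. Written as a sum over the possible crossing indices. -/
noncomputable def crossingSum (v : ℝ≥0 → ℝ) (a : ℝ≥0) (m : ℝ) (g : ℝ → ℝ) (n : ℕ) : ℝ :=
  ∑ k ∈ Finset.range (n + 2), if IsFirstCrossing v a m n k then g (v (gridTime a n k)) else 0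

section crossing

variable {v : ℝ≥0 → ℝ} {a : ℝ≥0} {m : ℝ} {g : ℝ → ℝ} {n : ℕ}

lemma IsFirstCrossing.unique {k l : ℕ} (hk : IsFirstCrossing v a m n k)
    (hl : IsFirstCrossing v a m n l) : k = l := by
  rcases lt_trichotomy k l with h | h | h
  · exact absurd (hl.2 k h) (not_le.2 hk.1)
  · exact h
  · exact absurd (hk.2 l h) (not_le.2 hl.1)

lemma crossingSum_eq {k : ℕ} (hk : k ≤ n + 1) (h : IsFirstCrossing v a m n k) :
    crossingSum v a m g n = g (v (gridTime a n k)) := by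
  rw [crossingSum, Finset.sum_eq_single k]
  · simp [h]
  · intro j _ hj
    rw [if_neg fun hj' ↦ hj (hj'.unique h)]
  · intro hk'
    exact absurd (Finset.mem_range.2 (by omega)) hk'

lemma crossingSum_eq_zero (h : ∀ k ≤ n + 1, ¬ IsFirstCrossing v a m n k) :
    crossingSum v a m g n = 0 := by
  refine Finset.sum_eq_zero fun k hk ↦ if_neg (h k ?_)
  have := Finset.mem_range.1 hk
  omega

lemma abs_crossingSum_le {C : ℝ} (hg : ∀ x, |g x| ≤ C) : |crossingSum v a m g n| ≤ C := by
  by_cases h : ∃ k ≤ n + 1, IsFirstCrossing v a m n k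
  · obtain ⟨k, hk, hc⟩ := h
    rw [crossingSum_eq hk hc]
    exact hg _
  · push Not at h
    rw [crossingSum_eq_zero h, abs_zero]
    exact (abs_nonneg _).trans (hg 0)

lemma exists_isFirstCrossing {k : ℕ} (h : m < v (gridTime a n k)) :
    ∃ j ≤ k, IsFirstCrossing v a m n j := by
  classical
  have hex : ∃ k, m < v (gridTime a n k) := ⟨k, h⟩
  exact ⟨Nat.find hex, Nat.find_min' hex h, Nat.find_spec hex,
    fun j hj ↦ not_lt.1 (Nat.find_min hex hj)⟩

/-- Rounding `s` down to the grid moves it by at most the mesh. -/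
lemma exists_gridTime_near (ha : 0 < a) (n : ℕ) {s : ℝ≥0} (hs : s ≤ a) :
    ∃ k ≤ n + 1, dist (gridTime a n k) s ≤ a / (n + 1) := by
  have ha' : (0 : ℝ) < a := ha
  have hs' : (s : ℝ) ≤ a := hs
  have hn : (0 : ℝ) < n + 1 := by positivity
  refine ⟨⌊(s : ℝ) * (n + 1) / a⌋₊, ?_, ?_⟩
  · refine Nat.floor_le_of_le ?_
    push_cast
    rw [div_le_iff₀ ha']
    nlinarith
  · have h1 := Nat.floor_le (a := (s : ℝ) * (n + 1) / a) (by positivity)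
    have h2 := Nat.lt_floor_add_one ((s : ℝ) * (n + 1) / a)
    set k := ⌊(s : ℝ) * (n + 1) / a⌋₊
    rw [le_div_iff₀ ha'] at h1
    rw [div_lt_iff₀ ha'] at h2
    rw [NNReal.dist_eq, gridTime]
    push_cast
    rw [abs_le]
    constructor
    · rw [neg_le_sub_iff_le_add, ← add_div, le_div_iff₀ hn]
      linarith
    · have : (a : ℝ) * k / (n + 1) ≤ s := by
        rw [div_le_iff₀ hn]
        linarith
      have : (0 : ℝ) ≤ a / (n + 1) := by positivity
      linarith

/-- As the mesh tends to `0`, the level reached at the first crossing of `m` on the grid tends to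
`m`, by uniform continuity: the previous grid value is at most `m`. -/
lemma tendsto_crossingSum (hv : Continuous v) (h0 : v 0 ≤ m) (hg : Continuous g)
    {s : ℝ≥0} (hs : s ≤ a) (hms : m < v s) :
    Tendsto (crossingSum v a m g) atTop (𝓝 (g m)) := by
  have ha : 0 < a := by
    rcases eq_or_ne s 0 with rfl | h
    · exact absurd h0 (not_le.2 hms)
    · exact (pos_iff_ne_zero.2 h).trans_le hs
  rw [Metric.tendsto_atTop]
  intro ε hε
  obtain ⟨η, hη, hgη⟩ := Metric.continuousAt_iff.1 (hg.continuousAt (x := m)) ε hε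
  obtain ⟨δ₁, hδ₁, h₁⟩ := Metric.uniformContinuousOn_iff.1
    ((isCompact_Iic_nnreal a).uniformContinuousOn_of_continuous hv.continuousOn) η hη
  obtain ⟨δ₂, hδ₂, h₂⟩ := Metric.continuousAt_iff.1 (hv.continuousAt (x := s)) (v s - m)
    (by linarith)
  have hlim : Tendsto (fun n : ℕ ↦ (a : ℝ) / (n + 1)) atTop (𝓝 0) := by
    simpa [div_eq_mul_inv] using
      (tendsto_one_div_add_atTop_nhds_zero_nat (𝕜 := ℝ)).const_mul (a : ℝ)
  obtain ⟨N, hN⟩ := eventually_atTop.1 (hlim.eventually_lt_const (lt_min hδ₁ hδ₂))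
  refine ⟨N, fun n hn ↦ ?_⟩
  have hmesh := lt_min_iff.1 (hN n hn)
  obtain ⟨k, hk, hks⟩ := exists_gridTime_near ha n hs
  have hvk : m < v (gridTime a n k) := by
    have := h₂ (hks.trans_lt hmesh.2)
    rw [Real.dist_eq, abs_lt] at this
    linarith
  obtain ⟨j, hjk, hj⟩ := exists_isFirstCrossing hvk
  rw [crossingSum_eq (hjk.trans hk) hj]
  apply hgη
  obtain ⟨i, rfl⟩ : ∃ i, j = i + 1 := by
    refine Nat.exists_eq_succ_of_ne_zero ?_
    rintro rfl
    have := hj.1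
    rw [gridTime_zero] at this
    linarith
  have hprev := hj.2 i (Nat.lt_succ_self i)
  have := h₁ _ (gridTime_le (hjk.trans hk)) _ (gridTime_le (by omega : i ≤ n + 1))
    (by rw [dist_gridTime_succ]; exact hmesh.1)
  rw [Real.dist_eq, abs_lt] at this ⊢
  constructor <;> linarith [hj.1]

lemma tendsto_crossingSum_of_forall_le (h : ∀ t ≤ a, v t ≤ m) :
    Tendsto (crossingSum v a m g) atTop (𝓝 0) := by
  refine tendsto_const_nhds.congr fun n ↦ ?_
  refine (crossingSum_eq_zero fun k hk hc ↦ ?_).symm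
  exact absurd (h _ (gridTime_le hk)) (not_le.2 hc.1)

end crossing

section reflection

variable {Ω : Type*} {mΩ : MeasurableSpace Ω} {P : Measure Ω} {V : ℝ≥0 → Ω → ℝ} {a : ℝ≥0}

open Classical in
/-- The discrete reflection: changing the sign of the increment `V a - V t` after the grid time `t`
of the first crossing turns the endpoint `V a` into `2 V t - V a`, and leaves the joint law of the
increment and of the grid values up to `t` unchanged. -/
lemma integral_firstCrossing_reflect [IsFiniteMeasure P] (hV : ∀ t, AEMeasurable (V t) P)
    {n k : ℕ} {m : ℝ}
    (hind : IndepFun (V a - V (gridTime a n k)) (fun ω (u : Set.Iic (gridTime a n k)) ↦ V u ω) P)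
    (hsymm : IdentDistrib (V a - V (gridTime a n k)) (-(V a - V (gridTime a n k))) P P)
    {f : ℝ → ℝ} (hf : Measurable f) :
    ∫ ω, (if IsFirstCrossing (V · ω) a m n k then f (V a ω) else 0) ∂P =
      ∫ ω, (if IsFirstCrossing (V · ω) a m n k then f (2 * V (gridTime a n k) ω - V a ω)
        else 0) ∂P := by
  set t := gridTime a n k with ht
  -- only finitely many coordinates of the past are kept: a process with a.e.-measurable
  -- coordinates need not be a.e.-measurable as a map into an uncountable product
  let past : Ω → Fin (k + 1) → ℝ := fun ω j ↦ V (gridTime a n j) ω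
  let proj : (Set.Iic t → ℝ) → Fin (k + 1) → ℝ := fun u j ↦
    u ⟨gridTime a n j, gridTime_mono a n (Nat.lt_succ_iff.1 j.2)⟩
  have hproj : Measurable proj := measurable_pi_lambda _ fun _ ↦ measurable_pi_apply _
  have hpast : IndepFun (V a - V t) past P := hind.comp measurable_id hproj
  have hident : IdentDistrib (fun ω ↦ ((V a - V t) ω, past ω))
      (fun ω ↦ ((-(V a - V t)) ω, past ω)) P P :=
    hsymm.prodMk (IdentDistrib.refl (aemeasurable_pi_lambda _ fun j ↦ hV _)) hpast
      (hpast.comp measurable_neg measurable_id)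
  let A : Set (Fin (k + 1) → ℝ) := {u | m < u (Fin.last k) ∧ ∀ j : Fin k, u j.castSucc ≤ m}
  have hA : MeasurableSet A := by
    have hA' : A = {u | m < u (Fin.last k)} ∩ ⋂ j : Fin k, {u | u j.castSucc ≤ m} := by
      ext u
      simp [A]
    rw [hA']
    exact (measurableSet_lt measurable_const (measurable_pi_apply _)).inter
      (MeasurableSet.iInter fun j ↦ measurableSet_le (measurable_pi_apply _) measurable_const)
  have hAiff (ω : Ω) : past ω ∈ A ↔ IsFirstCrossing (V · ω) a m n k := by
    simp [A, past, IsFirstCrossing, Fin.forall_iff]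
  let G : ℝ × (Fin (k + 1) → ℝ) → ℝ := fun p ↦
    if p.2 ∈ A then f (p.2 (Fin.last k) + p.1) else 0
  have hG : Measurable G := by
    refine Measurable.ite (measurable_snd hA) (hf.comp ?_) measurable_const
    exact ((measurable_pi_apply _).comp measurable_snd).add measurable_fst
  have key := (hident.comp hG).integral_eq
  convert key using 2
  · funext ω
    simp [G, hAiff, past, ht]
  · funext ω
    simp only [G, Function.comp_apply, hAiff, Pi.neg_apply, Pi.sub_apply]
    congr 2
    simp only [past, Fin.val_last, ← ht]
    ring

/-- The hypotheses of the reflection principle on `[0, a]`: almost all paths are continuous and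
start at `0`, and the increment from any `t ≤ a` to `a` is symmetric and independent of the path up
to `t`. -/
structure HasSymmIncrements (V : ℝ≥0 → Ω → ℝ) (a : ℝ≥0) (P : Measure Ω) : Prop where
  aemeasurable : ∀ t, AEMeasurable (V t) P
  cont : ∀ᵐ ω ∂P, Continuous (V · ω)
  zero : ∀ᵐ ω ∂P, V 0 ω = 0
  indep : ∀ t ≤ a, IndepFun (V a - V t) (fun ω (u : Set.Iic t) ↦ V u ω) P
  symm : ∀ t ≤ a, IdentDistrib (V a - V t) (-(V a - V t)) P P

lemma nullMeasurableSet_isFirstCrossing (hV : ∀ t, AEMeasurable (V t) P) (m : ℝ) (n k : ℕ) :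
    NullMeasurableSet {ω | IsFirstCrossing (V · ω) a m n k} P := by
  have : {ω | IsFirstCrossing (V · ω) a m n k} =
      {ω | m < V (gridTime a n k) ω} ∩ ⋂ j : Fin k, {ω | V (gridTime a n j) ω ≤ m} := by
    ext ω
    simp [IsFirstCrossing, Fin.forall_iff]
  rw [this]
  exact (nullMeasurableSet_lt aemeasurable_const (hV _)).inter
    (NullMeasurableSet.iInter fun j ↦ nullMeasurableSet_le (hV _) aemeasurable_const)

open Classical in
lemma aemeasurable_ite_firstCrossing (hV : ∀ t, AEMeasurable (V t) P) (m : ℝ) (n k : ℕ)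
    {h : Ω → ℝ} (hh : AEMeasurable h P) :
    AEMeasurable (fun ω ↦ if IsFirstCrossing (V · ω) a m n k then h ω else 0) P :=
  hh.indicator₀ (nullMeasurableSet_isFirstCrossing hV m n k)

open Classical in
/-- The reflection principle against bounded continuous functions: both sides are limits of the
expectations of the crossing sums, which agree on every grid. -/
lemma HasSymmIncrements.integral_reflect [IsFiniteMeasure P] (h : HasSymmIncrements V a P)
    {m : ℝ} (hm : 0 ≤ m) (f : BoundedContinuousFunction ℝ ℝ) :
    ∫ ω, (if m < runningSup V a ω then f (V a ω) else 0) ∂P =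
      ∫ ω, (if m < runningSup V a ω then f (2 * m - V a ω) else 0) ∂P := by
  have hmeas (n : ℕ) (g : ℝ → Ω → ℝ) (hg : ∀ t, AEMeasurable (fun ω ↦ g (V t ω) ω) P) :
      AEStronglyMeasurable (fun ω ↦ crossingSum (V · ω) a m (g · ω) n) P := by
    refine AEMeasurable.aestronglyMeasurable ?_
    unfold crossingSum
    exact Finset.aemeasurable_fun_sum _ fun k _ ↦
      aemeasurable_ite_firstCrossing h.aemeasurable m n k (hg _)
  have hlim (g : ℝ → Ω → ℝ) (hc : ∀ ω, Continuous (g · ω)) (hb : ∀ x ω, |g x ω| ≤ ‖f‖)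
      (hg : ∀ t, AEMeasurable (fun ω ↦ g (V t ω) ω) P) :
      Tendsto (fun n ↦ ∫ ω, crossingSum (V · ω) a m (g · ω) n ∂P) atTop
        (𝓝 (∫ ω, (if m < runningSup V a ω then g m ω else 0) ∂P)) := by
    refine tendsto_integral_of_dominated_convergence (fun _ ↦ ‖f‖) (fun n ↦ hmeas n g hg)
      (integrable_const _) (fun n ↦ ae_of_all _ fun ω ↦ abs_crossingSum_le (hb · ω)) ?_
    filter_upwards [h.cont, h.zero] with ω hω h0
    split_ifs with hM
    · obtain ⟨s, hs, hVs⟩ := exists_eq_runningSup (a := a) hω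
      exact tendsto_crossingSum hω (h0.trans_le hm) (hc ω) hs (by rwa [hVs])
    · exact tendsto_crossingSum_of_forall_le fun t ht ↦ (le_runningSup hω ht).trans (not_lt.1 hM)
  have h1 := hlim (fun _ ω ↦ f (V a ω)) (fun ω ↦ continuous_const)
    (fun x ω ↦ f.norm_coe_le_norm _) (fun t ↦ f.continuous.measurable.comp_aemeasurable
      (h.aemeasurable a))
  have h2 := hlim (fun y ω ↦ f (2 * y - V a ω)) (fun ω ↦ by fun_prop)
    (fun x ω ↦ f.norm_coe_le_norm _) (fun t ↦ f.continuous.measurable.comp_aemeasurable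
      (((h.aemeasurable t).const_mul 2).sub (h.aemeasurable a)))
  refine tendsto_nhds_unique (h1.congr fun n ↦ ?_) h2
  have hint (k : ℕ) (g : Ω → ℝ) (hg : AEMeasurable g P) (hb : ∀ ω, |g ω| ≤ ‖f‖) :
      Integrable (fun ω ↦ if IsFirstCrossing (V · ω) a m n k then g ω else 0) P := by
    refine Integrable.of_bound
      (aemeasurable_ite_firstCrossing h.aemeasurable m n k hg).aestronglyMeasurable ‖f‖
      (ae_of_all _ fun ω ↦ ?_)
    split_ifs
    · exact hb ω
    · simp
  simp only [crossingSum]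
  have hfa : AEMeasurable (fun ω ↦ f (V a ω)) P :=
    f.continuous.measurable.comp_aemeasurable (h.aemeasurable a)
  have hfr (k : ℕ) : AEMeasurable (fun ω ↦ f (2 * V (gridTime a n k) ω - V a ω)) P :=
    f.continuous.measurable.comp_aemeasurable
      (((h.aemeasurable _).const_mul 2).sub (h.aemeasurable a))
  rw [integral_finsetSum _ fun k _ ↦ hint k _ hfa fun ω ↦ f.norm_coe_le_norm _,
    integral_finsetSum _ fun k _ ↦ hint k _ (hfr k) fun ω ↦ f.norm_coe_le_norm _]
  refine Finset.sum_congr rfl fun k hk ↦ ?_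
  have hk' : gridTime a n k ≤ a := gridTime_le (by have := Finset.mem_range.1 hk; omega)
  exact integral_firstCrossing_reflect h.aemeasurable (h.indep _ hk') (h.symm _ hk')
    f.continuous.measurable

/-- **Reflection principle**: on the event that the path exceeds the level `m ≥ 0` before time `a`,
its endpoint and the reflection of its endpoint at `m` have the same law. -/
theorem HasSymmIncrements.map_restrict_reflect [IsFiniteMeasure P] (h : HasSymmIncrements V a P)
    {m : ℝ} (hm : 0 ≤ m) :
    (P.restrict {ω | m < runningSup V a ω}).map (V a) =
      (P.restrict {ω | m < runningSup V a ω}).map (fun ω ↦ 2 * m - V a ω) := by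
  classical
  have hnull : NullMeasurableSet {ω | m < runningSup V a ω} P :=
    nullMeasurableSet_lt aemeasurable_const (aemeasurable_runningSup h.aemeasurable)
  have hVa := (h.aemeasurable a).restrict (s := {ω | m < runningSup V a ω})
  refine ext_of_forall_integral_eq_of_IsFiniteMeasure fun f ↦ ?_
  rw [integral_map hVa f.continuous.aestronglyMeasurable,
    integral_map (hVa.const_sub _) f.continuous.aestronglyMeasurable,
    ← integral_indicator₀ hnull, ← integral_indicator₀ hnull]
  exact h.integral_reflect hm f

end reflection

/-! ### Gaussian integrals -/

section gaussianIntegrals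

lemma lintegral_Ioi_mul_exp_neg_mul_sq {b : ℝ} (hb : 0 < b) :
    ∫⁻ x in Set.Ioi (0 : ℝ), ENNReal.ofReal (x * Real.exp (-b * x ^ 2)) =
      ENNReal.ofReal (1 / (2 * b)) := by
  rw [← ofReal_integral_eq_lintegral_ofReal (integrable_mul_exp_neg_mul_sq hb).integrableOn]
  · congr 1
    have := integral_rpow_mul_exp_neg_mul_rpow (p := 2) (q := 1) (b := b) two_pos (by norm_num) hb
    norm_num [Real.rpow_neg_one] at this
    simp only [neg_mul]
    rw [this]
    field_simp
  · filter_upwards [self_mem_ae_restrict measurableSet_Ioi] with x hx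
    have hx' : (0 : ℝ) < x := hx
    simp only [Pi.zero_apply]
    positivity

lemma gaussianPDFReal_mul_gaussianPDFReal (p q : ℝ≥0) (y z : ℝ) :
    gaussianPDFReal 0 p y * gaussianPDFReal 0 q z =
      1 / (2 * Real.pi * (√p * √q)) * Real.exp (-(y ^ 2 / (2 * p) + z ^ 2 / (2 * q))) := by
  simp only [gaussianPDFReal, sub_zero]
  rw [mul_mul_mul_comm, ← Real.exp_add, ← mul_inv, ← Real.sqrt_mul (by positivity),
    ← Real.sqrt_mul (by positivity)]
  congr 1
  · rw [one_div, show 2 * Real.pi * (p : ℝ) * (2 * Real.pi * q) = (2 * Real.pi) ^ 2 * (p * q) by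
      ring, Real.sqrt_mul (by positivity), Real.sqrt_sq (by positivity)]
  · congr 1
    ring

variable {p q : ℝ≥0}

/-- `∫_{v > 0} v ρ(v / 2) γ(v) dv` for the centered Gaussian densities `ρ`, `γ` of variances `p`,
`q`. -/
lemma lintegral_Ioi_mul_gaussianPDF (hp : p ≠ 0) (hq : q ≠ 0) :
    ∫⁻ v in Set.Ioi (0 : ℝ), gaussianPDF 0 q v * (gaussianPDF 0 p (v / 2) * ENNReal.ofReal v) =
      ENNReal.ofReal (2 * (√p * √q) / (Real.pi * (q + 4 * p))) := by
  have hp' : (0 : ℝ) < p := by positivity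
  have hq' : (0 : ℝ) < q := by positivity
  have hb : (0 : ℝ) < 1 / (8 * p) + 1 / (2 * q) := by positivity
  have hK : (0 : ℝ) ≤ 1 / (2 * Real.pi * (√p * √q)) := by positivity
  have hcongr (v : ℝ) :
      gaussianPDF 0 q v * (gaussianPDF 0 p (v / 2) * ENNReal.ofReal v) =
        ENNReal.ofReal (1 / (2 * Real.pi * (√p * √q))) *
          ENNReal.ofReal (v * Real.exp (-(1 / (8 * p) + 1 / (2 * q) : ℝ) * v ^ 2)) := by
    rw [gaussianPDF, gaussianPDF, ← ENNReal.ofReal_mul (gaussianPDFReal_nonneg _ _ _),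
      ← ENNReal.ofReal_mul (gaussianPDFReal_nonneg _ _ _), ← ENNReal.ofReal_mul hK]
    congr 1
    rw [← mul_assoc, mul_comm (gaussianPDFReal 0 q v), gaussianPDFReal_mul_gaussianPDFReal,
      mul_assoc, mul_comm _ v]
    congr 3
    ring
  simp_rw [hcongr]
  rw [lintegral_const_mul _ (by fun_prop), lintegral_Ioi_mul_exp_neg_mul_sq hb,
    ← ENNReal.ofReal_mul hK]
  congr 1
  have h1 := Real.mul_self_sqrt hp'.le
  have h2 := Real.mul_self_sqrt hq'.le
  have hsp : 0 < √(p : ℝ) := Real.sqrt_pos.2 hp'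
  have hsq : 0 < √(q : ℝ) := Real.sqrt_pos.2 hq'
  rw [← h1, ← h2]
  simp only [Real.sqrt_mul_self hsp.le, Real.sqrt_mul_self hsq.le]
  field_simp
  ring

lemma integral_inv_one_add_mul_sq {c : ℝ} (hc : 0 < c) :
    ∫ w in (-1 : ℝ)..1, (1 + (c * w) ^ 2)⁻¹ = 2 * Real.arctan c / c := by
  rw [intervalIntegral.integral_comp_mul_left (fun w ↦ (1 + w ^ 2)⁻¹) hc.ne',
    integral_inv_one_add_sq]
  simp only [mul_neg, mul_one, Real.arctan_neg, smul_eq_mul]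
  ring

/-- The probability that `|V| ≤ 2 N` for independent centered Gaussian variables `N`, `V` of
variances `p`, `q`, computed in the coordinates `(n, w)` with `v = 2 n w`. -/
lemma lintegral_gaussianPDF_mul_gaussianReal_Ioc (hp : p ≠ 0) (hq : q ≠ 0) :
    ∫⁻ n, gaussianPDF 0 p n * gaussianReal 0 q (Set.Ioc (-(2 * n)) (2 * n)) =
      ENNReal.ofReal (Real.arctan (2 * √p / √q) / Real.pi) := by
  have hp' : (0 : ℝ) < p := by positivity
  have hq' : (0 : ℝ) < q := by positivity
  have hsp : 0 < √(p : ℝ) := Real.sqrt_pos.2 hp'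
  have hsq : 0 < √(q : ℝ) := Real.sqrt_pos.2 hq'
  have hcont : Continuous (gaussianPDFReal 0 q) := by
    unfold gaussianPDFReal
    fun_prop
  have hcontp : Continuous (gaussianPDFReal 0 p) := by
    unfold gaussianPDFReal
    fun_prop
  have hscale {n : ℝ} (hn : 0 < n) : gaussianReal 0 q (Set.Ioc (-(2 * n)) (2 * n)) =
      ∫⁻ w in Set.Ioc (-1 : ℝ) 1, ENNReal.ofReal (2 * n * gaussianPDFReal 0 q (2 * n * w)) := by
    rw [gaussianReal_apply_eq_integral _ hq,
      ← intervalIntegral.integral_of_le (by linarith : -(2 * n) ≤ 2 * n),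
      ← ofReal_integral_eq_lintegral_ofReal]
    · rw [← intervalIntegral.integral_of_le (by norm_num : (-1 : ℝ) ≤ 1),
        intervalIntegral.integral_const_mul,
        intervalIntegral.mul_integral_comp_mul_left]
      simp
    · exact (Continuous.integrableOn_Icc (by fun_prop)).mono_set Set.Ioc_subset_Icc_self
    · exact ae_of_all _ fun w ↦ mul_nonneg (by positivity) (gaussianPDFReal_nonneg _ _ _)
  have hinner (w : ℝ) : ∫⁻ n in Set.Ioi (0 : ℝ),
      ENNReal.ofReal (gaussianPDFReal 0 p n * (2 * n * gaussianPDFReal 0 q (2 * n * w))) =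
        ENNReal.ofReal (√p / (Real.pi * √q) * (1 + (2 * √p / √q * w) ^ 2)⁻¹) := by
    have hb : (0 : ℝ) < 1 / (2 * p) + 2 * w ^ 2 / q := by positivity
    have hK : (0 : ℝ) ≤ 2 * (1 / (2 * Real.pi * (√p * √q))) := by positivity
    have hcongr (n : ℝ) :
        ENNReal.ofReal (gaussianPDFReal 0 p n * (2 * n * gaussianPDFReal 0 q (2 * n * w))) =
          ENNReal.ofReal (2 * (1 / (2 * Real.pi * (√p * √q)))) *
            ENNReal.ofReal (n * Real.exp (-(1 / (2 * p) + 2 * w ^ 2 / q : ℝ) * n ^ 2)) := by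
      rw [← ENNReal.ofReal_mul hK]
      congr 1
      rw [mul_left_comm, gaussianPDFReal_mul_gaussianPDFReal,
        show (-(n ^ 2 / (2 * p) + (2 * n * w) ^ 2 / (2 * q)) : ℝ) =
          -(1 / (2 * p) + 2 * w ^ 2 / q : ℝ) * n ^ 2 by ring]
      ring
    simp_rw [hcongr]
    rw [lintegral_const_mul _ (by fun_prop), lintegral_Ioi_mul_exp_neg_mul_sq hb,
      ← ENNReal.ofReal_mul hK]
    congr 1
    have h1 := Real.mul_self_sqrt hp'.le
    have h2 := Real.mul_self_sqrt hq'.le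
    rw [← h1, ← h2]
    simp only [Real.sqrt_mul_self hsp.le, Real.sqrt_mul_self hsq.le]
    field_simp
  have hsupp : ∫⁻ n, gaussianPDF 0 p n * gaussianReal 0 q (Set.Ioc (-(2 * n)) (2 * n)) =
      ∫⁻ n in Set.Ioi (0 : ℝ),
        gaussianPDF 0 p n * gaussianReal 0 q (Set.Ioc (-(2 * n)) (2 * n)) := by
    rw [← lintegral_indicator measurableSet_Ioi]
    refine lintegral_congr fun n ↦ ?_
    by_cases hn : 0 < n
    · rw [Set.indicator_of_mem (Set.mem_Ioi.2 hn)]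
    · rw [Set.indicator_of_notMem (by simpa using hn), Set.Ioc_eq_empty (by linarith)]
      simp
  rw [hsupp]
  calc
    _ = ∫⁻ n in Set.Ioi (0 : ℝ), ∫⁻ w in Set.Ioc (-1 : ℝ) 1,
          ENNReal.ofReal (gaussianPDFReal 0 p n * (2 * n * gaussianPDFReal 0 q (2 * n * w))) := by
      refine setLIntegral_congr_fun measurableSet_Ioi fun n hn ↦ ?_
      rw [hscale hn, ← lintegral_const_mul _ (by fun_prop)]
      refine lintegral_congr fun w ↦ ?_
      rw [gaussianPDF, ← ENNReal.ofReal_mul (gaussianPDFReal_nonneg _ _ _)]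
    _ = ∫⁻ w in Set.Ioc (-1 : ℝ) 1,
          ENNReal.ofReal (√p / (Real.pi * √q) * (1 + (2 * √p / √q * w) ^ 2)⁻¹) := by
      rw [lintegral_lintegral_swap]
      · simp_rw [hinner]
      · exact Measurable.aemeasurable (by fun_prop)
    _ = _ := by
      have hc : 0 < 2 * √(p : ℝ) / √q := by positivity
      rw [← ofReal_integral_eq_lintegral_ofReal]
      · rw [← intervalIntegral.integral_of_le (by norm_num : (-1 : ℝ) ≤ 1),
          intervalIntegral.integral_const_mul, integral_inv_one_add_mul_sq hc]
        congr 1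
        field_simp
      · refine (Continuous.integrableOn_Icc ?_).mono_set Set.Ioc_subset_Icc_self
        refine continuous_const.mul (Continuous.inv₀ (by fun_prop) fun w ↦ ?_)
        positivity
      · refine ae_of_all _ fun w ↦ ?_
        simp only [Pi.zero_apply]
        positivity

end gaussianIntegrals

/-! ### A Gaussian variable compared with a reflected pair -/

lemma setLIntegral_preimage_of_hasLaw {Ω α : Type*} {mΩ : MeasurableSpace Ω}
    {mα : MeasurableSpace α} {P : Measure Ω} {μ : Measure α} {X : Ω → α} (hX : HasLaw X μ P)
    {S : Set α} (hS : MeasurableSet S) {g : α → ℝ≥0∞} (hg : Measurable g) :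
    ∫⁻ ω in X ⁻¹' S, g (X ω) ∂P = ∫⁻ y, S.indicator g y ∂μ := by
  rw [← hX.map_eq, lintegral_map' (hg.indicator hS).aemeasurable hX.aemeasurable,
    ← lintegral_indicator₀ (hX.aemeasurable.nullMeasurableSet_preimage hS)]
  rfl

section reflectedPair

variable {Ω : Type*} {mΩ : MeasurableSpace Ω} {P : Measure Ω} {N V M : Ω → ℝ}
  {p q : ℝ≥0}

/-- `P(M < N + V / 2)` disintegrated along the value `x` of `N + V / 2`, for `N` Gaussian and
independent of `(V, M)`: given `(V, M)`, the sum has density `x ↦ ρ (x - V / 2)`. Replacing `M < x`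
by `M ≤ x` changes, for each outcome, a single `x`. -/
lemma measure_lt_add_half [IsProbabilityMeasure P] (hp : p ≠ 0) (hN : HasLaw N (gaussianReal 0 p) P)
    (hV : AEMeasurable V P) (hM : AEMeasurable M P) (hM0 : ∀ᵐ ω ∂P, 0 ≤ M ω)
    (hind : IndepFun N (fun ω ↦ (V ω, M ω)) P) :
    P {ω | M ω < N ω + V ω / 2} =
      ∫⁻ x in Set.Ioi (0 : ℝ), ∫⁻ ω in {ω | M ω ≤ x}, gaussianPDF 0 p (x - V ω / 2) ∂P := by
  have hVM : AEMeasurable (fun ω ↦ (V ω, M ω)) P := hV.prodMk hM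
  have hfin := Measure.isProbabilityMeasure_map hVM
  have hpdf := measurable_gaussianPDF 0 p
  have hS : MeasurableSet {z : ℝ × ℝ × ℝ | z.2.2 < z.1 + z.2.1 / 2} :=
    measurableSet_lt (by fun_prop) (by fun_prop)
  have hF : Measurable fun z : (ℝ × ℝ) × ℝ ↦
      Set.indicator {z : (ℝ × ℝ) × ℝ | z.1.2 ≤ z.2}
        (fun z ↦ gaussianPDF 0 p (z.2 - z.1.1 / 2)) z :=
    (hpdf.comp (by fun_prop)).indicator (measurableSet_le (by fun_prop) (by fun_prop))
  have hsec (y : ℝ × ℝ) : gaussianReal 0 p {n | y.2 < n + y.1 / 2} =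
      ∫⁻ x, Set.indicator {z : (ℝ × ℝ) × ℝ | z.1.2 ≤ z.2}
        (fun z ↦ gaussianPDF 0 p (z.2 - z.1.1 / 2)) (y, x) := by
    rw [gaussianReal_apply _ hp,
      ← lintegral_indicator (measurableSet_lt (by fun_prop) (by fun_prop)),
      ← lintegral_sub_right_eq_self _ (y.1 / 2)]
    refine lintegral_congr_ae ?_
    have hne : ∀ᵐ x : ℝ, x ≠ y.2 := by simp [ae_iff]
    filter_upwards [hne] with x hx
    by_cases h : y.2 < x
    · rw [Set.indicator_of_mem (by simpa using h), Set.indicator_of_mem (by simpa using h.le)]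
    · rw [Set.indicator_of_notMem (by simpa using h), Set.indicator_of_notMem]
      simpa using (not_lt.1 h).lt_of_ne hx
  calc
    P {ω | M ω < N ω + V ω / 2}
      = P.map (fun ω ↦ (N ω, V ω, M ω)) {z | z.2.2 < z.1 + z.2.1 / 2} := by
        rw [Measure.map_apply_of_aemeasurable (hN.aemeasurable.prodMk hVM) hS]
        rfl
    _ = ∫⁻ y, gaussianReal 0 p {n | y.2 < n + y.1 / 2} ∂(P.map fun ω ↦ (V ω, M ω)) := by
        rw [(indepFun_iff_map_prod_eq_prod_map_map hN.aemeasurable hVM).1 hind, hN.map_eq,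
          Measure.prod_apply_symm hS]
        rfl
    _ = ∫⁻ x, ∫⁻ y, Set.indicator {z : (ℝ × ℝ) × ℝ | z.1.2 ≤ z.2}
        (fun z ↦ gaussianPDF 0 p (z.2 - z.1.1 / 2)) (y, x) ∂(P.map fun ω ↦ (V ω, M ω)) := by
        simp_rw [hsec]
        exact lintegral_lintegral_swap hF.aemeasurable
    _ = ∫⁻ x, Set.indicator (Set.Ioi 0)
        (fun x ↦ ∫⁻ ω in {ω | M ω ≤ x}, gaussianPDF 0 p (x - V ω / 2) ∂P) x := by
        refine lintegral_congr_ae ?_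
        have hne : ∀ᵐ x : ℝ, x ≠ 0 := by simp [ae_iff]
        filter_upwards [hne] with x hx0
        refine (lintegral_map' (hF.comp measurable_prodMk_right).aemeasurable hVM).trans ?_
        by_cases hx : 0 < x
        · rw [Set.indicator_of_mem (Set.mem_Ioi.2 hx),
            ← lintegral_indicator₀ (nullMeasurableSet_le hM aemeasurable_const)]
          rfl
        · rw [Set.indicator_of_notMem (by simpa using hx), ← lintegral_zero]
          refine lintegral_congr_ae ?_
          filter_upwards [hM0] with ω hω
          rw [Function.comp_apply, Set.indicator_of_notMem]
          have := (not_lt.1 hx).lt_of_ne hx0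
          simp only [Set.mem_ofPred_eq, not_le]
          linarith
    _ = _ := lintegral_indicator measurableSet_Ioi _

/-- The reflection at `x` exchanges the paths that exceed `x` and end below it with those that end
above it, and turns `x - V / 2` into `V / 2`. -/
lemma setLIntegral_reflect {x : ℝ} (hV : AEMeasurable V P) (hM : AEMeasurable M P)
    (hq : q ≠ 0) (hlaw : HasLaw V (gaussianReal 0 q) P) (hVM : ∀ᵐ ω ∂P, V ω ≤ M ω)
    (hrefl : (P.restrict {ω | x < M ω}).map V =
      (P.restrict {ω | x < M ω}).map (fun ω ↦ 2 * x - V ω)) {g : ℝ → ℝ≥0∞} (hg : Measurable g) :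
    ∫⁻ ω in {ω | M ω ≤ x}, g (x - V ω / 2) ∂P + ∫⁻ ω in {ω | x < V ω}, g (V ω / 2) ∂P =
      ∫⁻ ω in {ω | V ω ≤ x}, g (x - V ω / 2) ∂P := by
  have hMx : NullMeasurableSet {ω | M ω ≤ x} P := nullMeasurableSet_le hM aemeasurable_const
  have hMx' : NullMeasurableSet {ω | x < M ω} P := nullMeasurableSet_lt aemeasurable_const hM
  have hVx : NullMeasurableSet {ω | V ω ≤ x} P := nullMeasurableSet_le hV aemeasurable_const
  have hVx' : NullMeasurableSet {ω | x < V ω} P := nullMeasurableSet_lt aemeasurable_const hV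
  have hne : ∀ᵐ ω ∂P, V ω ≠ x := by
    have := nullSingletonClass_gaussianReal (μ := 0) hq
    have h0 : ∀ᵐ y ∂(P.map V), y ≠ x := by
      rw [hlaw.map_eq]
      simp [ae_iff]
    exact ae_of_ae_map hV h0
  have hG : Measurable (Set.indicator (Set.Iic x) fun v ↦ g (x - v / 2)) :=
    (hg.comp (by fun_prop)).indicator measurableSet_Iic
  have key := congrArg (fun μ ↦ ∫⁻ v, Set.indicator (Set.Iic x) (fun v ↦ g (x - v / 2)) v ∂μ) hrefl
  beta_reduce at key
  rw [lintegral_map' hG.aemeasurable hV.restrict,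
    lintegral_map' hG.aemeasurable (hV.restrict.const_sub _), ← lintegral_indicator₀ hMx',
    ← lintegral_indicator₀ hMx'] at key
  rw [← lintegral_indicator₀ hMx, ← lintegral_indicator₀ hVx, ← lintegral_indicator₀ hVx']
  have h1 : ∫⁻ ω, Set.indicator {ω | x < V ω} (fun ω ↦ g (V ω / 2)) ω ∂P =
      ∫⁻ ω, Set.indicator {ω | x < M ω}
        (fun ω ↦ Set.indicator (Set.Iic x) (fun v ↦ g (x - v / 2)) (2 * x - V ω)) ω ∂P := by
    refine lintegral_congr_ae ?_
    filter_upwards [hVM, hne] with ω h1 h2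
    by_cases h : x < V ω
    · rw [Set.indicator_of_mem (by exact h), Set.indicator_of_mem (by exact h.trans_le h1),
        Set.indicator_of_mem (Set.mem_Iic.2 (by linarith))]
      congr 1
      ring
    · rw [Set.indicator_of_notMem (by exact h), Set.indicator_apply]
      split_ifs
      · rw [Set.indicator_of_notMem]
        have := (not_lt.1 h).lt_of_ne h2
        simp only [Set.mem_Iic, not_le]
        linarith
      · rfl
  rw [h1, ← key, ← lintegral_add_right']
  · refine lintegral_congr_ae ?_
    filter_upwards [hVM] with ω h
    by_cases h' : M ω ≤ x
    · rw [Set.indicator_of_mem (by exact h'), Set.indicator_of_notMem (by simpa using h'),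
        Set.indicator_of_mem (by exact h.trans h'), add_zero]
    · rw [Set.indicator_of_notMem (by exact h'),
        Set.indicator_of_mem (s := {ω | x < M ω}) (by simpa using h'), zero_add]
      rfl
  · exact (hG.comp_aemeasurable hV).indicator₀ hMx'

lemma measurable_indicator_lt_half (p : ℝ≥0) :
    Measurable fun z : ℝ × ℝ ↦
      Set.indicator {z : ℝ × ℝ | z.1 < z.2} (fun z ↦ gaussianPDF 0 p (z.2 / 2)) z :=
  ((measurable_gaussianPDF 0 p).comp (by fun_prop)).indicator
    (measurableSet_lt (by fun_prop) (by fun_prop))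

lemma setLIntegral_lt_half_eq (hlaw : HasLaw V (gaussianReal 0 q) P) (x : ℝ) :
    ∫⁻ ω in {ω | x < V ω}, gaussianPDF 0 p (V ω / 2) ∂P =
      ∫⁻ v, Set.indicator {z : ℝ × ℝ | z.1 < z.2} (fun z ↦ gaussianPDF 0 p (z.2 / 2)) (x, v)
        ∂(gaussianReal 0 q) :=
  setLIntegral_preimage_of_hasLaw hlaw measurableSet_Ioi
    ((measurable_gaussianPDF 0 p).comp (measurable_id.div_const 2))

/-- The mean of `ρ(V / 2)` on `{x < V}`, integrated over `x > 0`, is the mean of `V⁺ ρ(V / 2)`. -/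
lemma lintegral_lintegral_lt (hp : p ≠ 0) (hq : q ≠ 0) (hlaw : HasLaw V (gaussianReal 0 q) P) :
    ∫⁻ x in Set.Ioi (0 : ℝ), ∫⁻ ω in {ω | x < V ω}, gaussianPDF 0 p (V ω / 2) ∂P =
      ENNReal.ofReal (2 * (√p * √q) / (Real.pi * (q + 4 * p))) := by
  have hpdf := measurable_gaussianPDF 0 p
  have houter (v : ℝ) : ∫⁻ x in Set.Ioi (0 : ℝ), Set.indicator {z : ℝ × ℝ | z.1 < z.2}
      (fun z ↦ gaussianPDF 0 p (z.2 / 2)) (x, v) =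
        gaussianPDF 0 p (v / 2) * ENNReal.ofReal v := by
    calc
      _ = ∫⁻ x in Set.Ioi (0 : ℝ),
          Set.indicator (Set.Iio v) (fun _ ↦ gaussianPDF 0 p (v / 2)) x := rfl
      _ = _ := by
        rw [lintegral_indicator_const measurableSet_Iio, Measure.restrict_apply measurableSet_Iio,
          Set.Iio_inter_Ioi, Real.volume_Ioo, sub_zero]
  simp_rw [setLIntegral_lt_half_eq hlaw (p := p)]
  rw [lintegral_lintegral_swap (measurable_indicator_lt_half p).aemeasurable]
  simp_rw [houter]
  rw [gaussianReal_of_var_ne_zero _ hq, lintegral_withDensity_eq_lintegral_mul _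
    (measurable_gaussianPDF 0 q) (by fun_prop), ← lintegral_Ioi_mul_gaussianPDF hp hq,
    ← lintegral_indicator measurableSet_Ioi]
  refine lintegral_congr fun v ↦ ?_
  by_cases hv : 0 < v
  · rw [Set.indicator_of_mem (Set.mem_Ioi.2 hv)]
    rfl
  · rw [Set.indicator_of_notMem (by simpa using hv)]
    simp [ENNReal.ofReal_of_nonpos (not_lt.1 hv)]

/-- This is the probability that `|V| ≤ 2 N` for `N` independent of `V` with density `ρ`. -/
lemma lintegral_lintegral_le (hp : p ≠ 0) (hq : q ≠ 0) (hlaw : HasLaw V (gaussianReal 0 q) P) :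
    ∫⁻ x in Set.Ioi (0 : ℝ), ∫⁻ ω in {ω | V ω ≤ x}, gaussianPDF 0 p (x - V ω / 2) ∂P =
      ENNReal.ofReal (Real.arctan (2 * √p / √q) / Real.pi) := by
  have hpdf := measurable_gaussianPDF 0 p
  have hF : Measurable fun z : ℝ × ℝ ↦ Set.indicator {z : ℝ × ℝ | z.2 ≤ z.1}
      (fun z ↦ gaussianPDF 0 p (z.1 - z.2 / 2)) z :=
    (hpdf.comp (by fun_prop)).indicator (measurableSet_le (by fun_prop) (by fun_prop))
  have hinner (x : ℝ) : ∫⁻ ω in {ω | V ω ≤ x}, gaussianPDF 0 p (x - V ω / 2) ∂P =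
      ∫⁻ v, Set.indicator {z : ℝ × ℝ | z.2 ≤ z.1} (fun z ↦ gaussianPDF 0 p (z.1 - z.2 / 2)) (x, v)
        ∂(gaussianReal 0 q) := by
    exact setLIntegral_preimage_of_hasLaw hlaw measurableSet_Iic
      (hpdf.comp ((measurable_id.div_const 2).const_sub x))
  have hT : MeasurableSet {z : ℝ × ℝ | z.2 ∈ Set.Ioc (-(2 * z.1)) (2 * z.1)} := by
    have h1 : MeasurableSet {z : ℝ × ℝ | -(2 * z.1) < z.2} :=
      measurableSet_lt (by fun_prop) (by fun_prop)
    have h2 : MeasurableSet {z : ℝ × ℝ | z.2 ≤ 2 * z.1} :=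
      measurableSet_le (by fun_prop) (by fun_prop)
    exact h1.inter h2
  have hH : Measurable fun z : ℝ × ℝ ↦
      Set.indicator {z : ℝ × ℝ | z.2 ∈ Set.Ioc (-(2 * z.1)) (2 * z.1)}
        (fun z ↦ gaussianPDF 0 p z.1) z := (hpdf.comp measurable_fst).indicator hT
  -- the substitution `x = n + v / 2` turns `x > 0`, `v ≤ x` into `|v| ≤ 2 n`
  have houter (v : ℝ) : ∫⁻ x in Set.Ioi (0 : ℝ), Set.indicator {z : ℝ × ℝ | z.2 ≤ z.1}
      (fun z ↦ gaussianPDF 0 p (z.1 - z.2 / 2)) (x, v) =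
        ∫⁻ n, Set.indicator {z : ℝ × ℝ | z.2 ∈ Set.Ioc (-(2 * z.1)) (2 * z.1)}
        (fun z ↦ gaussianPDF 0 p z.1) (n, v) := by
    rw [← lintegral_indicator measurableSet_Ioi, ← lintegral_add_right_eq_self _ (v / 2)]
    refine lintegral_congr fun n ↦ ?_
    simp only [Set.indicator_apply, Set.mem_Ioi, Set.mem_ofPred_eq, Set.mem_Ioc,
      add_sub_cancel_right]
    split_ifs with h1 h2 h3 h3 h3
    · rfl
    · exact absurd ⟨by linarith, by linarith⟩ h3
    · exact absurd (by linarith [h3.2]) h2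
    · rfl
    · exact absurd (by linarith [h3.1]) h1
    · rfl
  simp_rw [hinner]
  rw [lintegral_lintegral_swap hF.aemeasurable]
  simp_rw [houter]
  rw [lintegral_lintegral_swap (f := fun v n ↦ Set.indicator
    {z : ℝ × ℝ | z.2 ∈ Set.Ioc (-(2 * z.1)) (2 * z.1)} (fun z ↦ gaussianPDF 0 p z.1) (n, v))
    (hH.comp measurable_swap).aemeasurable,
    ← lintegral_gaussianPDF_mul_gaussianReal_Ioc hp hq]
  refine lintegral_congr fun n ↦ ?_
  rw [← lintegral_indicator_const measurableSet_Ioc]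
  rfl

/-- `P(M < N + V / 2)` when `(V, M)` obeys the reflection principle and `N` is independent of it. -/
theorem measure_lt_add_half_add [IsProbabilityMeasure P] (hp : p ≠ 0) (hq : q ≠ 0)
    (hN : HasLaw N (gaussianReal 0 p) P)
    (hV : HasLaw V (gaussianReal 0 q) P) (hM : AEMeasurable M P) (hM0 : ∀ᵐ ω ∂P, 0 ≤ M ω)
    (hVM : ∀ᵐ ω ∂P, V ω ≤ M ω) (hind : IndepFun N (fun ω ↦ (V ω, M ω)) P)
    (hrefl : ∀ x : ℝ, 0 ≤ x → (P.restrict {ω | x < M ω}).map V =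
      (P.restrict {ω | x < M ω}).map (fun ω ↦ 2 * x - V ω)) :
    P {ω | M ω < N ω + V ω / 2} + ENNReal.ofReal (2 * (√p * √q) / (Real.pi * (q + 4 * p))) =
      ENNReal.ofReal (Real.arctan (2 * √p / √q) / Real.pi) := by
  have hpdf := measurable_gaussianPDF 0 p
  rw [measure_lt_add_half hp hN hV.aemeasurable hM hM0 hind, ← lintegral_lintegral_lt hp hq hV,
    ← lintegral_lintegral_le hp hq hV, ← lintegral_add_right']
  · refine setLIntegral_congr_fun measurableSet_Ioi fun x hx ↦ ?_
    exact setLIntegral_reflect hV.aemeasurable hM hq hV hVM (hrefl x (le_of_lt hx)) hpdf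
  · simp_rw [setLIntegral_lt_half_eq hV (p := p)]
    exact (measurable_indicator_lt_half p).lintegral_prod_right'.aemeasurable

end reflectedPair

/-! ### Gaussian structure of the Slepian process -/

section slepian

variable {Ω : Type*} {mΩ : MeasurableSpace Ω} {P : Measure Ω} {B : ℝ≥0 → Ω → ℝ} {a : ℝ≥0}

lemma hasLaw_gaussianReal_zero {X : Ω → ℝ} {v : ℝ≥0} (hX : HasGaussianLaw X P) (h0 : P[X] = 0)
    (hv : cov[X, X; P] = v) : HasLaw X (gaussianReal 0 v) P := by
  refine ⟨hX.aemeasurable, ?_⟩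
  rw [hX.map_eq_gaussianReal, h0, ← covariance_self hX.aemeasurable, hv, Real.toNNReal_coe]

lemma identDistrib_neg_of_hasGaussianLaw {X : Ω → ℝ} (hX : HasGaussianLaw X P) (h0 : P[X] = 0) :
    IdentDistrib X (-X) P P := by
  refine ⟨hX.aemeasurable, hX.aemeasurable.neg, ?_⟩
  have h0' : P[-X] = 0 := by simp [integral_neg, h0]
  rw [hX.map_eq_gaussianReal, hX.neg.map_eq_gaussianReal, h0, h0', variance_neg]

lemma ProbabilityTheory.IsPreBrownianReal.isGaussianProcess_slepian (hB : IsPreBrownianReal B P) :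
    IsGaussianProcess (slepianProcess B) P :=
  hB.isGaussianProcess.of_isGaussianProcess fun t ↦ ⟨{t + 1, t},
    { toFun x := x ⟨t + 1, by simp⟩ - x ⟨t, by simp⟩
      map_add' x y := by simp; abel
      map_smul' c x := by simp; ring }, by simp [slepianProcess]⟩

lemma ProbabilityTheory.IsPreBrownianReal.integral_slepian (hB : IsPreBrownianReal B P) (t : ℝ≥0) :
    P[slepianProcess B t] = 0 := by
  unfold slepianProcess
  rw [integral_sub (hB.integrable_eval _) (hB.integrable_eval _), hB.integral_eval,
    hB.integral_eval, sub_zero]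

lemma ProbabilityTheory.IsPreBrownianReal.memLp_slepian (hB : IsPreBrownianReal B P) (t : ℝ≥0) :
    MemLp (slepianProcess B t) 2 P :=
  (hB.isGaussianProcess_slepian.hasGaussianLaw_eval t).memLp_two

lemma ProbabilityTheory.IsPreBrownianReal.covariance_slepian (hB : IsPreBrownianReal B P)
    {s t : ℝ≥0} (hst : s ≤ t) (ht : t ≤ 1) :
    cov[slepianProcess B s, slepianProcess B t; P] = 1 - ((t : ℝ) - s) := by
  have := hB.isGaussianProcess.isProbabilityMeasure
  have hm (t : ℝ≥0) : MemLp (B t) 2 P := (hB.isGaussianProcess.hasGaussianLaw_eval t).memLp_two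
  unfold slepianProcess
  have h1 : t ≤ s + 1 := ht.trans (by simp)
  have h2 : s ≤ t + 1 := hst.trans (by simp)
  have h3 : s + 1 ≤ t + 1 := by gcongr
  rw [covariance_fun_sub_fun_sub (hm _) (hm _) (hm _) (hm _), hB.covariance_eval,
    hB.covariance_eval, hB.covariance_eval, hB.covariance_eval, min_eq_left h3, min_eq_right h1,
    min_eq_left h2, min_eq_left hst]
  push_cast
  ring

/-- The increments of the Slepian process, reversed in sign: on `[0, 1]` this is a Brownian motion
of variance `2 t`. -/
def slepianDrop (B : ℝ≥0 → Ω → ℝ) : ℝ≥0 → Ω → ℝ :=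
  fun t ω ↦ slepianProcess B 0 ω - slepianProcess B t ω

lemma ProbabilityTheory.IsPreBrownianReal.aemeasurable_slepianDrop (hB : IsPreBrownianReal B P)
    (t : ℝ≥0) : AEMeasurable (slepianDrop B t) P :=
  (hB.isGaussianProcess_slepian.aemeasurable 0).sub (hB.isGaussianProcess_slepian.aemeasurable t)

lemma continuous_slepianProcess {ω : Ω} (h : Continuous (B · ω)) :
    Continuous (slepianProcess B · ω) :=
  (h.comp (continuous_add_const 1)).sub h

lemma indepFun_of_covariance_eq_zero_left {ι : Type*} {X : Ω → ℝ} {Y : ι → Ω → ℝ}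
    (hXY : IsGaussianProcess (Sum.elim (fun _ : Unit ↦ X) Y) P)
    (h : ∀ i, cov[X, Y i; P] = 0) : IndepFun X (fun ω i ↦ Y i ω) P :=
  have hφ : Measurable fun x : Unit → ℝ ↦ x () := measurable_pi_apply ()
  (hXY.indepFun_of_covariance_eq_zero (fun _ ↦ hXY.aemeasurable (Sum.inl ()))
    (fun i ↦ hXY.aemeasurable (Sum.inr i)) fun _ i ↦ h i).comp hφ measurable_id

lemma ProbabilityTheory.IsPreBrownianReal.isGaussianProcess_sumElim (hB : IsPreBrownianReal B P)
    {ι : Type*} (c d : ℝ) (s t : ℝ≥0) (f : ι → ℝ≥0) :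
    IsGaussianProcess (Sum.elim
      (fun _ : Unit ↦ fun ω ↦ c * slepianProcess B s ω + d * slepianProcess B t ω)
      fun i ↦ slepianDrop B (f i)) P :=
  hB.isGaussianProcess_slepian.of_isGaussianProcess fun i ↦ match i with
    | Sum.inl _ => ⟨{s, t},
      { toFun x := c * x ⟨s, by simp⟩ + d * x ⟨t, by simp⟩
        map_add' x y := by simp; ring
        map_smul' c x := by simp; ring }, by simp⟩
    | Sum.inr i => ⟨{0, f i},
      { toFun x := x ⟨0, by simp⟩ - x ⟨f i, by simp⟩
        map_add' x y := by simp; ring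
        map_smul' c x := by simp; ring }, by simp [slepianDrop]⟩

lemma ProbabilityTheory.IsBrownianReal.hasSymmIncrements_slepianDrop (hB : IsBrownianReal B P)
    (ha : a ≤ 1) : HasSymmIncrements (slepianDrop B) a P where
  aemeasurable := hB.aemeasurable_slepianDrop
  cont := by
    filter_upwards [hB.cont] with ω hω
    exact continuous_const.sub (continuous_slepianProcess hω)
  zero := by simp [slepianDrop]
  indep t ht := by
    have := hB.isGaussianProcess.isProbabilityMeasure
    have hS := hB.memLp_slepian
    have hg := hB.isGaussianProcess_sumElim 1 (-1) t a (fun u : Set.Iic t ↦ (u : ℝ≥0))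
    have heq : slepianDrop B a - slepianDrop B t =
        fun ω ↦ 1 * slepianProcess B t ω + -1 * slepianProcess B a ω := by
      ext ω
      simp [slepianDrop]
      ring
    rw [heq]
    refine indepFun_of_covariance_eq_zero_left hg ?_
    rintro ⟨u, hu : u ≤ t⟩
    have hcov : cov[fun ω ↦ slepianProcess B t ω - slepianProcess B a ω,
        fun ω ↦ slepianProcess B 0 ω - slepianProcess B u ω; P] = 0 := by
      rw [covariance_fun_sub_fun_sub (hS _) (hS _) (hS _) (hS _),
        covariance_comm (slepianProcess B t), hB.covariance_slepian zero_le (ht.trans ha),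
        covariance_comm (slepianProcess B t), hB.covariance_slepian hu (ht.trans ha),
        covariance_comm (slepianProcess B a), hB.covariance_slepian zero_le ha,
        covariance_comm (slepianProcess B a), hB.covariance_slepian (hu.trans ht) ha]
      ring
    simp only [one_mul, neg_one_mul, ← sub_eq_add_neg]
    exact hcov
  symm t ht := by
    have heq : slepianDrop B a - slepianDrop B t = slepianProcess B t - slepianProcess B a := by
      ext ω
      simp [slepianDrop]
    rw [heq]
    refine identDistrib_neg_of_hasGaussianLaw hB.isGaussianProcess_slepian.hasGaussianLaw_sub ?_
    have hi (t : ℝ≥0) := (hB.isGaussianProcess_slepian.hasGaussianLaw_eval t).integrable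
    rw [integral_sub' (hi _) (hi _), hB.integral_slepian, hB.integral_slepian, sub_zero]

/-- The midpoint `(S_0 + S_a) / 2` of the endpoints of the Slepian process on `[0, a]`. -/
noncomputable def slepianMidpoint (B : ℝ≥0 → Ω → ℝ) (a : ℝ≥0) (ω : Ω) : ℝ :=
  (slepianProcess B 0 ω + slepianProcess B a ω) / 2

/-- The endpoint midpoint has variance `1 - a / 2`. -/
lemma ProbabilityTheory.IsPreBrownianReal.hasLaw_slepianMidpoint (hB : IsPreBrownianReal B P)
    (ha : a ≤ 1) : HasLaw (slepianMidpoint B a) (gaussianReal 0 (1 - a / 2)) P := by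
  have := hB.isGaussianProcess.isProbabilityMeasure
  have hS := hB.memLp_slepian
  have hi (t : ℝ≥0) := (hB.isGaussianProcess_slepian.hasGaussianLaw_eval t).integrable
  have heq : slepianMidpoint B a = (2⁻¹ : ℝ) • (slepianProcess B 0 + slepianProcess B a) := by
    ext ω
    simp [slepianMidpoint]
    ring
  rw [heq]
  refine hasLaw_gaussianReal_zero (hB.isGaussianProcess_slepian.hasGaussianLaw_add.smul _) ?_ ?_
  · simp only [Pi.smul_apply, integral_smul, Pi.add_apply]
    rw [integral_add (hi _) (hi _), hB.integral_slepian, hB.integral_slepian]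
    simp
  · rw [covariance_smul_left, covariance_smul_right,
      covariance_add_left (hS _) (hS _) ((hS _).add (hS _)),
      covariance_add_right (hS _) (hS _) (hS _), covariance_add_right (hS _) (hS _) (hS _),
      covariance_comm (slepianProcess B a), hB.covariance_slepian le_rfl zero_le_one,
      hB.covariance_slepian zero_le ha, hB.covariance_slepian le_rfl ha,
      NNReal.coe_sub ((NNReal.half_le_self a).trans ha)]
    push_cast
    ring

lemma ProbabilityTheory.IsPreBrownianReal.hasLaw_slepianDrop (hB : IsPreBrownianReal B P)
    (ha : a ≤ 1) : HasLaw (slepianDrop B a) (gaussianReal 0 (2 * a)) P := by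
  have := hB.isGaussianProcess.isProbabilityMeasure
  have hS := hB.memLp_slepian
  have hi (t : ℝ≥0) := (hB.isGaussianProcess_slepian.hasGaussianLaw_eval t).integrable
  have heq : slepianDrop B a = slepianProcess B 0 - slepianProcess B a := rfl
  rw [heq]
  refine hasLaw_gaussianReal_zero hB.isGaussianProcess_slepian.hasGaussianLaw_sub ?_ ?_
  · rw [integral_sub' (hi _) (hi _), hB.integral_slepian, hB.integral_slepian, sub_zero]
  · rw [covariance_sub_sub (hS _) (hS _) (hS _) (hS _), covariance_comm (slepianProcess B a),
      hB.covariance_slepian le_rfl zero_le_one,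
      hB.covariance_slepian zero_le ha, hB.covariance_slepian le_rfl ha]
    push_cast
    ring

lemma ProbabilityTheory.IsPreBrownianReal.indepFun_slepianMidpoint (hB : IsPreBrownianReal B P)
    (ha : a ≤ 1) :
    IndepFun (slepianMidpoint B a)
      (fun ω ↦ (slepianDrop B a ω, runningSup (slepianDrop B) a ω)) P := by
  have := hB.isGaussianProcess.isProbabilityMeasure
  have hS := hB.memLp_slepian
  have hg := hB.isGaussianProcess_sumElim 2⁻¹ 2⁻¹ 0 a (fun u : Set.Iic a ↦ (u : ℝ≥0))
  have hind : IndepFun (slepianMidpoint B a) (fun ω (u : Set.Iic a) ↦ slepianDrop B u ω) P := by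
    have heq : slepianMidpoint B a =
        fun ω ↦ 2⁻¹ * slepianProcess B 0 ω + 2⁻¹ * slepianProcess B a ω := by
      ext ω
      simp [slepianMidpoint]
      ring
    rw [heq]
    refine indepFun_of_covariance_eq_zero_left hg ?_
    rintro ⟨u, hu : u ≤ a⟩
    have hcov : cov[(2⁻¹ : ℝ) • slepianProcess B 0 + (2⁻¹ : ℝ) • slepianProcess B a,
        slepianProcess B 0 - slepianProcess B u; P] = 0 := by
      rw [covariance_add_left ((hS _).const_smul _) ((hS _).const_smul _) ((hS _).sub (hS _)),
        covariance_smul_left, covariance_smul_left,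
        covariance_sub_right (hS _) (hS _) (hS _), covariance_sub_right (hS _) (hS _) (hS _),
        covariance_comm (slepianProcess B a), covariance_comm (slepianProcess B a),
        hB.covariance_slepian le_rfl zero_le_one, hB.covariance_slepian zero_le ha,
        hB.covariance_slepian zero_le (hu.trans ha), hB.covariance_slepian hu ha]
      push_cast
      ring
    exact hcov
  have hmeas : Measurable fun w : Set.Iic a → ℝ ↦
      (w ⟨a, le_refl a⟩, ⨆ n : ℕ, w (TopologicalSpace.denseSeq (Set.Iic a) n)) :=
    (measurable_pi_apply _).prodMk (Measurable.iSup fun n ↦ measurable_pi_apply _)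
  exact hind.comp measurable_id hmeas

end slepian

/-! ### The first zero of the Slepian process -/

section firstZero

variable {Ω : Type*} {X : ℝ≥0 → Ω → ℝ} {ω : Ω}

lemma firstZero_le_iff (hX : Continuous (X · ω)) (a : ℝ≥0) :
    firstZero X ω ≤ a ↔ ∃ t ≤ a, X t ω = 0 := by
  constructor
  · intro h
    have hclosed : IsClosed {t : ℝ≥0 | X t ω = 0} := isClosed_eq hX continuous_const
    have hne : {t : ℝ≥0 | X t ω = 0}.Nonempty := by
      by_contra hempty
      have hnone : {s : ℝ≥0∞ | ∃ t : ℝ≥0, s = (t : ℝ≥0∞) ∧ X t ω = 0} = ∅ := by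
        ext s
        simp only [Set.mem_ofPred_eq, Set.mem_empty_iff_false, iff_false]
        rintro ⟨t, -, ht⟩
        exact hempty ⟨t, ht⟩
      rw [firstZero, hnone, sInf_empty] at h
      exact ENNReal.coe_ne_top (top_le_iff.1 h)
    have hmem := hclosed.csInf_mem hne (OrderBot.bddBelow _)
    refine ⟨_, ?_, hmem⟩
    have hle : ((sInf {t : ℝ≥0 | X t ω = 0} : ℝ≥0) : ℝ≥0∞) ≤ firstZero X ω := by
      refine le_sInf ?_
      rintro _ ⟨t, rfl, ht⟩
      exact ENNReal.coe_le_coe.2 (csInf_le (OrderBot.bddBelow _) ht)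
    exact ENNReal.coe_le_coe.1 (hle.trans h)
  · rintro ⟨t, ht, hXt⟩
    have hmem : (t : ℝ≥0∞) ∈ {s : ℝ≥0∞ | ∃ t : ℝ≥0, s = (t : ℝ≥0∞) ∧ X t ω = 0} := ⟨t, rfl, hXt⟩
    exact (sInf_le hmem).trans (ENNReal.coe_le_coe.2 ht)

lemma not_exists_eq_zero_iff (hX : Continuous (X · ω)) (a : ℝ≥0) :
    (¬ ∃ t ≤ a, X t ω = 0) ↔ (∀ t ≤ a, 0 < X t ω) ∨ ∀ t ≤ a, X t ω < 0 := by
  constructor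
  · intro h
    by_contra! hcon
    obtain ⟨⟨s, hs, hXs⟩, t, ht, hXt⟩ := hcon
    have hmem : (0 : ℝ) ∈ Set.Icc (X s ω) (X t ω) := ⟨hXs, hXt⟩
    obtain ⟨u, hu, hXu⟩ :=
      (isPreconnected_Iic (a := a)).intermediate_value hs ht hX.continuousOn hmem
    exact h ⟨u, hu, hXu⟩
  · rintro (h | h) ⟨t, ht, hXt⟩
    · exact (h t ht).ne' hXt
    · exact (h t ht).ne hXt

end firstZero

section slepianFirstZero

variable {Ω : Type*} {mΩ : MeasurableSpace Ω} {P : Measure Ω} {B : ℝ≥0 → Ω → ℝ}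

lemma ProbabilityTheory.IsBrownianReal.nullMeasurableSet_slepian_neg (hB : IsBrownianReal B P)
    (a : ℝ≥0) : NullMeasurableSet {ω | ∀ t ≤ a, slepianProcess B t ω < 0} P := by
  have hS := hB.isGaussianProcess_slepian
  have hsup : NullMeasurableSet {ω | runningSup (slepianProcess B) a ω < 0} P :=
    nullMeasurableSet_lt (aemeasurable_runningSup hS.aemeasurable) aemeasurable_const
  refine hsup.congr ?_
  filter_upwards [hB.cont] with ω hω
  exact propext (runningSup_lt_iff (continuous_slepianProcess hω))

lemma slepian_neg_apply (B : ℝ≥0 → Ω → ℝ) (t : ℝ≥0) (ω : Ω) :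
    slepianProcess (-B) t ω = -(slepianProcess B t ω) := by
  simp [slepianProcess]
  ring

lemma ProbabilityTheory.IsBrownianReal.nullMeasurableSet_slepian_pos (hB : IsBrownianReal B P)
    (a : ℝ≥0) : NullMeasurableSet {ω | ∀ t ≤ a, 0 < slepianProcess B t ω} P := by
  have := hB.neg.nullMeasurableSet_slepian_neg a
  simpa only [slepian_neg_apply, neg_lt_zero] using this

/-- Without a zero in `[0, a]`, a continuous path keeps its sign there. -/
lemma ProbabilityTheory.IsBrownianReal.firstZero_gt_ae_eq (hB : IsBrownianReal B P) (a : ℝ≥0) :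
    ({ω | firstZero (slepianProcess B) ω ≤ a}ᶜ : Set Ω) =ᵐ[P]
      ({ω | ∀ t ≤ a, 0 < slepianProcess B t ω} ∪ {ω | ∀ t ≤ a, slepianProcess B t ω < 0} :
        Set Ω) := by
  filter_upwards [hB.cont] with ω hω
  have hc := continuous_slepianProcess hω
  exact propext ((not_congr (firstZero_le_iff hc a)).trans (not_exists_eq_zero_iff hc a))

lemma ProbabilityTheory.IsBrownianReal.nullMeasurableSet_firstZero_le (hB : IsBrownianReal B P)
    (a : ℝ≥0) : NullMeasurableSet {ω | firstZero (slepianProcess B) ω ≤ a} P := by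
  rw [← NullMeasurableSet.compl_iff]
  exact ((hB.nullMeasurableSet_slepian_pos a).union (hB.nullMeasurableSet_slepian_neg a)).congr
    (hB.firstZero_gt_ae_eq a).symm

theorem ProbabilityTheory.IsBrownianReal.aemeasurable_firstZero (hB : IsBrownianReal B P) :
    AEMeasurable (firstZero (slepianProcess B)) P := by
  -- null-measurability is measurability for the completed σ-algebra
  refine NullMeasurable.aemeasurable (measurable_of_Iic (α := ℝ≥0∞) (δ := NullMeasurableSpace Ω P)
    fun a ↦ ?_)
  induction a with
  | top =>
    change NullMeasurableSet (firstZero (slepianProcess B) ⁻¹' Set.Iic ⊤) P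
    simp
  | coe a => exact hB.nullMeasurableSet_firstZero_le a

/-- The probability that the Slepian process is positive on `[0, a]`: the paths for which both
endpoints are positive, minus those of them that touch zero. -/
theorem ProbabilityTheory.IsBrownianReal.measure_slepian_pos (hB : IsBrownianReal B P)
    {a : ℝ≥0} (ha0 : 0 < a) (ha : a ≤ 1) :
    P {ω | ∀ t ≤ a, 0 < slepianProcess B t ω} +
        ENNReal.ofReal (√a * √(2 - a) / (2 * Real.pi)) =
      ENNReal.ofReal (Real.arctan (√(2 - a) / √a) / Real.pi) := by
  have := hB.isGaussianProcess.isProbabilityMeasure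
  have hV := hB.hasSymmIncrements_slepianDrop ha
  have hhalf : a / 2 < 1 := (NNReal.half_lt_self ha0.ne').trans_le ha
  have hp : 1 - a / 2 ≠ 0 := (tsub_pos_of_lt hhalf).ne'
  have hq : 2 * a ≠ 0 := by positivity
  have key := measure_lt_add_half_add hp hq (hB.hasLaw_slepianMidpoint ha)
    (hB.hasLaw_slepianDrop ha) (aemeasurable_runningSup hV.aemeasurable)
    (by
      filter_upwards [hV.cont, hV.zero] with ω hω h0
      exact h0 ▸ le_runningSup hω zero_le)
    (by
      filter_upwards [hV.cont] with ω hω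
      exact le_runningSup hω le_rfl)
    (hB.indepFun_slepianMidpoint ha) (fun x hx ↦ hV.map_restrict_reflect hx)
  have hset : {ω | ∀ t ≤ a, 0 < slepianProcess B t ω} =ᵐ[P]
      ({ω | runningSup (slepianDrop B) a ω < slepianMidpoint B a ω + slepianDrop B a ω / 2} :
        Set Ω) := by
    filter_upwards [hV.cont] with ω hω
    refine propext (Iff.trans ?_ (runningSup_lt_iff hω).symm)
    refine forall₂_congr fun t ht ↦ ?_
    simp only [slepianMidpoint, slepianDrop]
    constructor <;> intro h <;> linarith
  have ha0' : (0 : ℝ) < a := ha0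
  have ha' : (a : ℝ) ≤ 1 := ha
  have hp' : ((1 - a / 2 : ℝ≥0) : ℝ) = (2 - a) / 2 := by
    rw [NNReal.coe_sub hhalf.le]
    push_cast
    ring
  have hs : 0 < √(2 - a : ℝ) := Real.sqrt_pos.2 (by linarith)
  have hr : 0 < √(a : ℝ) := Real.sqrt_pos.2 ha0'
  have h2 : 0 < √(2 : ℝ) := Real.sqrt_pos.2 two_pos
  have h22 : √(2 : ℝ) * √2 = 2 := Real.mul_self_sqrt two_pos.le
  rw [hp', NNReal.coe_mul, NNReal.coe_ofNat, Real.sqrt_div' _ two_pos.le,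
    Real.sqrt_mul two_pos.le] at key
  rw [measure_congr hset]
  convert key using 3
  · field_simp
    ring
  · congr 1
    field_simp
    linear_combination h22

/-- The distribution function on `[0, 1]` of the first zero of the Slepian process. The argument of
`arctan` is written so that the formula is continuous at `0` as it stands. -/
noncomputable def slepianZeroCDF (x : ℝ) : ℝ :=
  2 / Real.pi * Real.arctan (√x / √(2 - x)) + √x * √(2 - x) / Real.pi

lemma slepianZeroCDF_zero : slepianZeroCDF 0 = 0 := by simp [slepianZeroCDF]

lemma slepianZeroCDF_one : slepianZeroCDF 1 = 1 / 2 + 1 / Real.pi := by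
  have := Real.pi_ne_zero
  norm_num [slepianZeroCDF]
  field_simp
  norm_num

theorem ProbabilityTheory.IsBrownianReal.measure_firstZero_le (hB : IsBrownianReal B P)
    {a : ℝ≥0} (ha : a ≤ 1) :
    P {ω | firstZero (slepianProcess B) ω ≤ a} = ENNReal.ofReal (slepianZeroCDF a) := by
  have := hB.isGaussianProcess.isProbabilityMeasure
  rcases eq_or_ne a 0 with rfl | h0
  -- at `a = 0` the claim is that `S_0`, the midpoint for `a = 0`, has no atom at zero
  · rw [NNReal.coe_zero, slepianZeroCDF_zero, ENNReal.ofReal_zero]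
    have hlaw := hB.hasLaw_slepianMidpoint (a := 0) zero_le
    have hatom := nullSingletonClass_gaussianReal (μ := 0) (v := 1 - 0 / 2) (by simp)
    have hne : ∀ᵐ y ∂(P.map (slepianMidpoint B 0)), y ≠ 0 := by
      rw [hlaw.map_eq, ae_iff]
      simp only [ne_eq, not_not, Set.ofPred_eq_eq_singleton]
      exact measure_singleton 0
    suffices h : ∀ᵐ ω ∂P, ¬ firstZero (slepianProcess B) ω ≤ ((0 : ℝ≥0) : ℝ≥0∞) by
      simpa [ae_iff] using h
    filter_upwards [hB.cont, ae_of_ae_map hlaw.aemeasurable hne] with ω hω hN hF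
    refine hN ?_
    obtain ⟨t, ht, hSt⟩ := (firstZero_le_iff (continuous_slepianProcess hω) 0).1 hF
    obtain rfl : t = 0 := le_antisymm ht zero_le
    simp [slepianMidpoint, hSt]
  have ha0 : 0 < a := pos_iff_ne_zero.2 h0
  have ha0' : (0 : ℝ) < a := ha0
  have ha' : (a : ℝ) ≤ 1 := ha
  have hs : 0 < √(2 - a : ℝ) := Real.sqrt_pos.2 (by linarith)
  have hr : 0 < √(a : ℝ) := Real.sqrt_pos.2 ha0'
  have hpos := hB.measure_slepian_pos ha0 ha
  have hneg := hB.neg.measure_slepian_pos ha0 ha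
  simp only [slepian_neg_apply, neg_pos] at hneg
  have htoReal {s : Set Ω} {x y : ℝ} (hx : 0 ≤ x) (hy : 0 ≤ y)
      (h : P s + ENNReal.ofReal x = ENNReal.ofReal y) : P.real s = y - x := by
    have := congrArg ENNReal.toReal h
    rw [ENNReal.toReal_add (measure_ne_top _ _) ENNReal.ofReal_ne_top, ENNReal.toReal_ofReal hx,
      ENNReal.toReal_ofReal hy] at this
    exact eq_sub_of_add_eq this
  have hy : 0 ≤ Real.arctan (√(2 - a) / √a) / Real.pi :=
    div_nonneg (Real.arctan_nonneg.2 (by positivity)) Real.pi_pos.le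
  have hpos' := htoReal (by positivity) hy hpos
  have hneg' := htoReal (by positivity) hy hneg
  have hdisj : Disjoint {ω | ∀ t ≤ a, 0 < slepianProcess B t ω}
      {ω | ∀ t ≤ a, slepianProcess B t ω < 0} := by
    rw [Set.disjoint_left]
    intro ω h h'
    exact lt_asymm (h 0 zero_le) (h' 0 zero_le)
  have hcompl : P.real {ω | firstZero (slepianProcess B) ω ≤ a}ᶜ =
      2 * (Real.arctan (√(2 - a) / √a) / Real.pi - √a * √(2 - a) / (2 * Real.pi)) := by
    rw [measureReal_congr (hB.firstZero_gt_ae_eq a),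
      measureReal_union₀ (hB.nullMeasurableSet_slepian_neg a) hdisj.aedisjoint, hpos', hneg']
    ring
  rw [probReal_compl_eq_one_sub₀ (hB.nullMeasurableSet_firstZero_le a)] at hcompl
  rw [← ofReal_measureReal]
  congr 1
  have harctan : Real.arctan (√(2 - a) / √a) = Real.pi / 2 - Real.arctan (√a / √(2 - a)) := by
    rw [← inv_div, Real.arctan_inv_of_pos (by positivity)]
  rw [harctan] at hcompl
  rw [slepianZeroCDF]
  have hpi := Real.pi_ne_zero
  field_simp at hcompl ⊢
  linarith

lemma hasDerivAt_slepianZeroCDF {x : ℝ} (h0 : 0 < x) (h2 : x < 2) :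
    HasDerivAt slepianZeroCDF (1 / Real.pi * √((2 - x) / x)) x := by
  have hs : 0 < √(2 - x) := Real.sqrt_pos.2 (by linarith)
  have hr : 0 < √x := Real.sqrt_pos.2 h0
  have hs2 : √(2 - x) ^ 2 = 2 - x := Real.sq_sqrt (by linarith)
  have hr2 : √x ^ 2 = x := Real.sq_sqrt h0.le
  have hdr : HasDerivAt (fun x ↦ √x) (1 / (2 * √x)) x := Real.hasDerivAt_sqrt h0.ne'
  have hds : HasDerivAt (fun x : ℝ ↦ √(2 - x)) (-1 / (2 * √(2 - x))) x :=
    ((hasDerivAt_id x).const_sub 2).sqrt (by simp; linarith)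
  have h := (((hdr.div hds hs.ne').arctan).const_mul (2 / Real.pi)).add
    ((hdr.mul hds).div_const Real.pi)
  refine h.congr_deriv ?_
  rw [Real.sqrt_div (by linarith)]
  have hsum : √x ^ 2 + √(2 - x) ^ 2 = 2 := by rw [hs2, hr2]; ring
  set r := √x
  set s := √(2 - x)
  simp only [Pi.div_apply]
  have hpi := Real.pi_pos
  have h1 : 1 + (r / s) ^ 2 = 2 / s ^ 2 := by
    field_simp
    linarith
  rw [h1]
  field_simp
  nlinarith [hsum]

lemma continuousOn_slepianZeroCDF : ContinuousOn slepianZeroCDF (Set.Icc 0 1) := by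
  unfold slepianZeroCDF
  have hdiv : ContinuousOn (fun x : ℝ ↦ √x / √(2 - x)) (Set.Icc 0 1) := by
    refine ContinuousOn.div (by fun_prop) (by fun_prop) fun x hx ↦ ?_
    exact (Real.sqrt_pos.2 (by linarith [hx.2])).ne'
  exact (continuousOn_const.mul (Real.continuous_arctan.comp_continuousOn hdiv)).add (by fun_prop)

lemma setLIntegral_Icc_slepian_density {b : ℝ} (hb0 : 0 ≤ b) (hb1 : b ≤ 1) :
    ∫⁻ x in Set.Icc 0 b, ENNReal.ofReal (1 / Real.pi * √((2 - x) / x)) =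
      ENNReal.ofReal (slepianZeroCDF b) := by
  have hcont := continuousOn_slepianZeroCDF.mono (Set.Icc_subset_Icc_right hb1)
  have hderiv : ∀ x ∈ Set.Ioo 0 b,
      HasDerivAt slepianZeroCDF (1 / Real.pi * √((2 - x) / x)) x := fun x hx ↦
    hasDerivAt_slepianZeroCDF hx.1 (by linarith [hx.2])
  have hnonneg (x : ℝ) : 0 ≤ 1 / Real.pi * √((2 - x) / x) := by positivity
  have hint : IntegrableOn (fun x ↦ 1 / Real.pi * √((2 - x) / x)) (Set.Ioc 0 b) :=
    intervalIntegral.integrableOn_deriv_of_nonneg hcont hderiv fun x _ ↦ hnonneg x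
  have hftc := intervalIntegral.integral_eq_sub_of_hasDerivAt_of_le hb0 hcont hderiv
    ((intervalIntegrable_iff_integrableOn_Ioc_of_le hb0).2 hint)
  rw [slepianZeroCDF_zero, sub_zero, intervalIntegral.integral_of_le hb0] at hftc
  rw [setLIntegral_congr Ioc_ae_eq_Icc.symm, ← hftc, ofReal_integral_eq_lintegral_ofReal hint
    (ae_of_all _ hnonneg)]

/-- The law of the first zero, restricted to `[0, 1]`. -/
theorem ProbabilityTheory.IsBrownianReal.map_firstZero_restrict (hB : IsBrownianReal B P) :
    (P.restrict {ω | firstZero (slepianProcess B) ω ≤ 1}).map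
        (fun ω ↦ (firstZero (slepianProcess B) ω).toReal) =
      (volume.restrict (Set.Icc 0 1)).withDensity
        fun a ↦ ENNReal.ofReal (1 / Real.pi * √((2 - a) / a)) := by
  have := hB.isGaussianProcess.isProbabilityMeasure
  have hF := hB.aemeasurable_firstZero
  have hle : NullMeasurableSet {ω | firstZero (slepianProcess B) ω ≤ 1} P :=
    hF.nullMeasurableSet_preimage measurableSet_Iic
  refine Measure.ext_of_Iic _ _ fun b ↦ ?_
  rw [Measure.map_apply_of_aemeasurable hF.ennreal_toReal.restrict measurableSet_Iic,
    Measure.restrict_apply₀' hle,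
    withDensity_apply _ measurableSet_Iic, Measure.restrict_restrict measurableSet_Iic]
  rcases lt_or_ge b 0 with hb | hb
  · have h1 : (fun ω ↦ (firstZero (slepianProcess B) ω).toReal) ⁻¹' Set.Iic b = ∅ := by
      ext ω
      simpa using hb.trans_le ENNReal.toReal_nonneg
    have h2 : Set.Iic b ∩ Set.Icc 0 1 = ∅ := by
      ext x
      simp only [Set.mem_inter_iff, Set.mem_Iic, Set.mem_Icc, Set.mem_empty_iff_false, iff_false]
      rintro ⟨h, h', -⟩
      linarith
    simp [h1, h2]
  · have hmin : (0 : ℝ) ≤ min b 1 := le_min hb zero_le_one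
    have h1 : (fun ω ↦ (firstZero (slepianProcess B) ω).toReal) ⁻¹' Set.Iic b ∩
        {ω | firstZero (slepianProcess B) ω ≤ 1} =
          {ω | firstZero (slepianProcess B) ω ≤ (min b 1).toNNReal} := by
      ext ω
      simp only [Set.mem_inter_iff, Set.mem_preimage, Set.mem_Iic, Set.mem_ofPred_eq]
      change _ ↔ firstZero (slepianProcess B) ω ≤ ENNReal.ofReal (min b 1)
      rw [ENNReal.ofReal_min, le_min_iff, ENNReal.ofReal_one]
      refine and_congr_left fun h ↦ ?_
      rw [ENNReal.le_ofReal_iff_toReal_le (h.trans_lt ENNReal.one_lt_top).ne hb]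
    have h2 : Set.Iic b ∩ Set.Icc 0 1 = Set.Icc 0 (min b 1) := by
      ext x
      simp only [Set.mem_inter_iff, Set.mem_Iic, Set.mem_Icc, le_min_iff]
      tauto
    rw [h1, h2, hB.measure_firstZero_le (by simp),
      setLIntegral_Icc_slepian_density hmin (min_le_right _ _), Real.coe_toNNReal _ hmin]

end slepianFirstZero

theorem mainTheorem9 {Ω : Type*} [MeasurableSpace Ω] (P : Measure Ω) (B : ℝ≥0 → Ω → ℝ)
    (hB : IsBrownianReal B P) :
    AEMeasurable (firstZero (slepianProcess B)) P ∧
    (∀ A : Set ℝ, MeasurableSet A → A ⊆ Set.Icc 0 1 →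
      P {ω | firstZero (slepianProcess B) ω < ∞ ∧ (firstZero (slepianProcess B) ω).toReal ∈ A} =
        ∫⁻ a in A, ENNReal.ofReal ((1 / Real.pi) * Real.sqrt ((2 - a) / a))) ∧
    P {ω | firstZero (slepianProcess B) ω ≤ 1} = ENNReal.ofReal (1 / 2 + 1 / Real.pi) := by
  have hF := hB.aemeasurable_firstZero
  have hle : NullMeasurableSet {ω | firstZero (slepianProcess B) ω ≤ 1} P :=
    hF.nullMeasurableSet_preimage measurableSet_Iic
  refine ⟨hF, fun A hA hA01 ↦ ?_, ?_⟩
  · have hset : {ω | firstZero (slepianProcess B) ω < ∞ ∧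
        (firstZero (slepianProcess B) ω).toReal ∈ A} =
          (fun ω ↦ (firstZero (slepianProcess B) ω).toReal) ⁻¹' A ∩
            {ω | firstZero (slepianProcess B) ω ≤ 1} := by
      ext ω
      constructor
      · rintro ⟨hfin, hmem⟩
        refine ⟨hmem, ?_⟩
        have := (ENNReal.le_ofReal_iff_toReal_le hfin.ne zero_le_one).2 (hA01 hmem).2
        simpa using this
      · rintro ⟨hmem, hle⟩
        exact ⟨lt_of_le_of_lt hle ENNReal.one_lt_top, hmem⟩
    have hlaw := congrArg (· A) hB.map_firstZero_restrict
    beta_reduce at hlaw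
    rw [Measure.map_apply_of_aemeasurable hF.ennreal_toReal.restrict hA,
      Measure.restrict_apply₀' hle,
      withDensity_apply _ hA, Measure.restrict_restrict hA,
      Set.inter_eq_self_of_subset_left hA01] at hlaw
    rw [hset, hlaw]
  · have := hB.measure_firstZero_le (a := 1) le_rfl
    rw [NNReal.coe_one, slepianZeroCDF_one] at this
    exact_mod_cast this
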